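/- **Lemma 4.** Let $g:\mathbb R^n\to\mathbb R\cup\{+\infty\}$ be a proper, convex, lower semicontinuous function, let $\gamma>0$, and let $$\mathbf{prox}_{\gamma g}(u)=\operatorname*{argmin}_{w\in\mathbb R^n}\Big\{g(w)+\tfrac1{2\gamma}\|w-u\|^2\Big\}$$ be its proximity operator. Let $\mathsf M\subseteq\mathbb R^n$, and let $u^\star\in\mathbb R^n$ be such that $x^\star=\mathbf{prox}_{\gamma g}(u^\star)\in\mathsf M$. Suppose that $g$ is partly smooth at $x^\star$ relative to $\mathsf M$, that is, $\partial g(x^\star)\neq\emptyset$ (where $\partial g$ is the convex subdifferential) and * (smoothness) $\mathsf M$ is a $\mathcal C^2$-submanifold of $\mathbb R^n$ around $x^\star$: for some $p$ there is a map $\varphi$ into $\mathbb R^n$, of class $\mathcal C^2$ on an open neighbourhood of $0\in\mathbb R^p$ and a homeomorphism of that neighbourhood onto a neighbourhood of $x^\star$ in $\mathsf M$, with $\varphi(0)=x^\star$ and $D\varphi(0)$ injective; and the restriction of $g$ to $\mathsf M$ is $\mathcal C^2$ around $x^\star$, i.e. near $x^\star$ it coincides on $\mathsf M$ with a real-valued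 function that is $\mathcal C^2$ on a neighbourhood of $x^\star$ in $\mathbb R^n$; * (sharpness) the tangent space $T_{\mathsf M}(x^\star)=\operatorname{Im}D\varphi(0)$ equals $\big(\operatorname{par}\partial g(x^\star)\big)^\perp$, where $\operatorname{par}A$ is the linear space parallel to the affine hull of $A$; * (continuity) the set-valued mapping $\partial g$ is continuous at $x^\star$ relative to $\mathsf M$, i.e. outer and inner semicontinuous in the Painlevé–Kuratowski sense: $\limsup_{x\to x^\star,\,x\in\mathsf M}\partial g(x)\subseteq\partial g(x^\star)\subseteq\liminf_{x\to x^\star,\,x\in\mathsf M}\partial g(x)$. Suppose moreover that $\dfrac{u^\star-x^\star}{\gamma}\in\operatorname{ri}\partial g(x^\star)$, where $\operatorname{ri}$ denotes the relative interior. Then the qualifying condition holds: $$\exists\,\varepsilon>0\ \text{ such that for all } u\in\mathcal B(u^\star,\varepsilon),\quad \mathbf{prox}_{\gamma g}(u)\in\mathsf M .$$ -/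

import Mathlib

open Filter Topology Set

/-- Euclidean space `ℝⁿ`. -/
abbrev Euc (n : ℕ) : Type := EuclideanSpace ℝ (Fin n)

/-- A proper, convex, lower semicontinuous function `ℝⁿ → ℝ ∪ {+∞}`: it never takes the value
`-∞`, it is finite somewhere, its epigraph is convex, and it is lower semicontinuous. -/
structure IsProperConvexLSC {n : ℕ} (g : Euc n → EReal) : Prop where
  ne_bot : ∀ x, g x ≠ ⊥
  exists_ne_top : ∃ x, g x ≠ ⊤
  convex_epigraph : Convex ℝ {q : Euc n × ℝ | g q.1 ≤ (q.2 : EReal)}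
  lowerSemicontinuous : LowerSemicontinuous g

/-- The convex subdifferential `∂g(x)`. -/
def subdiff {n : ℕ} (g : Euc n → EReal) (x : Euc n) : Set (Euc n) :=
  {v | ∀ y, g x + ((inner ℝ v (y - x) : ℝ) : EReal) ≤ g y}

/-- The set of minimizers of `w ↦ g(w) + ‖w - u‖² / (2γ)`. -/
def proxArgmin {n : ℕ} (γ : ℝ) (g : Euc n → EReal) (u : Euc n) : Set (Euc n) :=
  {x | IsMinOn (fun w => g w + ((1 / (2 * γ) * ‖w - u‖ ^ 2 : ℝ) : EReal)) univ x}

/-- `x = prox_{γg}(u)`: the point `x` is the one and only minimizer of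
`w ↦ g(w) + ‖w - u‖² / (2γ)`. -/
def IsProx {n : ℕ} (γ : ℝ) (g : Euc n → EReal) (u x : Euc n) : Prop :=
  proxArgmin γ g u = {x}

/-- `φ` is a `C^k` local parametrization of `M` around `x`: on some open neighbourhood `U` of `0`,
`φ` is `C^k` and a homeomorphism onto a neighbourhood of `x` in `M`; moreover `φ(0) = x` and the
derivative of `φ` at `0` is injective. -/
def IsLocalParam {n p : ℕ} (k : WithTop ℕ∞) (M : Set (Euc n)) (x : Euc n)
    (φ : Euc p → Euc n) : Prop :=
  φ 0 = x ∧ Function.Injective (fderiv ℝ φ 0) ∧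
    ∃ U : Set (Euc p), IsOpen U ∧ 0 ∈ U ∧ ContDiffOn ℝ k φ U ∧
      IsEmbedding (U.domRestrict φ) ∧ φ '' U ⊆ M ∧ φ '' U ∈ 𝓝[M] x

/-- `M` is a `C^k` submanifold of `ℝⁿ` around its point `x`. -/
def IsSubmanifoldAround {n : ℕ} (k : WithTop ℕ∞) (M : Set (Euc n)) (x : Euc n) : Prop :=
  x ∈ M ∧ ∃ (p : ℕ) (φ : Euc p → Euc n), IsLocalParam k M x φ

/-- `T` is the tangent space `T_M(x)` of the `C^k` submanifold `M`: the image of the derivative at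
`0` of a local parametrization of `M` around `x` (it does not depend on the parametrization). -/
def IsTangentSpace {n : ℕ} (k : WithTop ℕ∞) (M : Set (Euc n)) (x : Euc n)
    (T : Submodule ℝ (Euc n)) : Prop :=
  ∃ (p : ℕ) (φ : Euc p → Euc n), IsLocalParam k M x φ ∧
    LinearMap.range (fderiv ℝ φ 0 : Euc p →ₗ[ℝ] Euc n) = T

/-- The restriction of `g` to `M` is `C^k` around `x`: near `x` it is finite on `M` and agrees there
with a function that is `C^k` near `x` in the ambient space. -/
def RestrictContDiffAround {n : ℕ} (k : WithTop ℕ∞) (g : Euc n → EReal) (M : Set (Euc n))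
    (x : Euc n) : Prop :=
  ∃ G : Euc n → ℝ, ContDiffAt ℝ k G x ∧ ∀ᶠ y in 𝓝[M] x, g y = (G y : EReal)

/-- The set-valued mapping `S` is continuous at `x` relative to `M` (Painlevé–Kuratowski):
the outer limit of `S(y)` as `y → x` in `M` is contained in `S(x)` (outer semicontinuity),
and `S(x)` is contained in the inner limit (inner semicontinuity). -/
def SetValuedContinuousAtRel {n : ℕ} (S : Euc n → Set (Euc n)) (M : Set (Euc n))
    (x : Euc n) : Prop :=
  (∀ v, (∀ V ∈ 𝓝 v, ∃ᶠ y in 𝓝[M] x, (S y ∩ V).Nonempty) → v ∈ S x) ∧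
    (∀ v ∈ S x, ∀ V ∈ 𝓝 v, ∀ᶠ y in 𝓝[M] x, (S y ∩ V).Nonempty)

/-- The proper convex lower semicontinuous function `g` is partly smooth at `x` relative
to `M`. The space parallel to the affine hull of a set `A` is `vectorSpan ℝ A`. -/
structure IsPartlySmoothAt {n : ℕ} (g : Euc n → EReal) (M : Set (Euc n)) (x : Euc n) : Prop where
  properConvexLSC : IsProperConvexLSC g
  subdiff_nonempty : (subdiff g x).Nonempty
  submanifold : IsSubmanifoldAround 2 M x
  smooth : RestrictContDiffAround 2 g M x
  sharp : IsTangentSpace 2 M x (vectorSpan ℝ (subdiff g x))ᗮ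
  continuous : SetValuedContinuousAtRel (subdiff g) M x

/-- The qualifying condition: `prox_{γg}` maps a ball around `u` into `M`. -/
def QualifyingCondition {n : ℕ} (γ : ℝ) (g : Euc n → EReal) (M : Set (Euc n))
    (u : Euc n) : Prop :=
  ∃ ε > 0, ∀ w ∈ Metric.ball u ε, ∃ x, IsProx γ g w x ∧ x ∈ M

/-! The argument is by contradiction. Nonexpansiveness of the proximity operator turns parameters `u
i → ustar` into proximal points `X i → xstar`, with subgradients `V i` tending to `v` in the
relative interior. If every `X i` misses `M`, take a nearest point on a compact piece of `M`: the
normalized residual is normal to `M`, so a limit direction `d` is normal at `xstar`, hence by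
sharpness parallel to the affine hull of the subdifferential. Thus `v + δ • d` is still a
subgradient at `xstar`, and inner semicontinuity approximates it by subgradients at the nearest
points. Monotonicity between these and `V i` gives, in the limit, `δ ≤ δ / 2`. -/

section Subdifferential

variable {n : ℕ} {g : Euc n → EReal}

lemma IsProperConvexLSC.ne_top_of_mem_subdiff (hg : IsProperConvexLSC g) {x v : Euc n}
    (hv : v ∈ subdiff g x) : g x ≠ ⊤ := by
  obtain ⟨y, hy⟩ := hg.exists_ne_top
  intro hx
  have h := hv y
  rw [hx, EReal.top_add_coe, top_le_iff] at h
  exact hy h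

/-- The convex subdifferential is a monotone operator. -/
lemma IsProperConvexLSC.inner_sub_nonneg (hg : IsProperConvexLSC g) {x y v w : Euc n}
    (hv : v ∈ subdiff g x) (hw : w ∈ subdiff g y) : 0 ≤ inner ℝ (v - w) (x - y) := by
  have h1 := hv y
  have h2 := hw x
  rw [← EReal.coe_toReal (hg.ne_top_of_mem_subdiff hv) (hg.ne_bot x),
    ← EReal.coe_toReal (hg.ne_top_of_mem_subdiff hw) (hg.ne_bot y)] at h1 h2
  norm_cast at h1 h2
  simp only [inner_sub_left, inner_sub_right] at *
  linarith

/-- Fermat's rule for the proximity operator. -/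
lemma IsProperConvexLSC.mem_subdiff_of_mem_proxArgmin (hg : IsProperConvexLSC g) {γ : ℝ}
    (hγ : 0 < γ) {u x : Euc n} (hx : x ∈ proxArgmin γ g u) :
    γ⁻¹ • (u - x) ∈ subdiff g x := by
  have hmin : ∀ w, g x + ((1 / (2 * γ) * ‖x - u‖ ^ 2 : ℝ) : EReal) ≤
      g w + ((1 / (2 * γ) * ‖w - u‖ ^ 2 : ℝ) : EReal) := fun w => hx (mem_univ w)
  have hxt : g x ≠ ⊤ := by
    obtain ⟨y, hy⟩ := hg.exists_ne_top
    intro h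
    have h' := hmin y
    rw [h, EReal.top_add_coe, top_le_iff, ← EReal.coe_toReal hy (hg.ne_bot y)] at h'
    exact EReal.coe_ne_top _ (by exact_mod_cast h')
  intro y
  by_cases hy : g y = ⊤
  · rw [hy]; exact le_top
  have ex := EReal.coe_toReal hxt (hg.ne_bot x)
  have ey := EReal.coe_toReal hy (hg.ne_bot y)
  set a := (g x).toReal
  set b := (g y).toReal
  -- Compare `x` with `(1 - t) • x + t • y` and divide by `t`: the quadratic error is then of order
  -- `t` and vanishes as `t → 0`.
  have key : ∀ t : ℝ, t ∈ Ioo (0 : ℝ) 1 →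
      a + inner ℝ (γ⁻¹ • (u - x)) (y - x) ≤ b + t * (1 / (2 * γ) * ‖y - x‖ ^ 2) := by
    intro t ht
    have hc := hg.convex_epigraph (x := (x, a)) (y := (y, b)) (by simp [ex]) (by simp [ey])
      (sub_nonneg.2 ht.2.le) ht.1.le (by ring)
    simp only [mem_ofPred_eq, Prod.fst_add, Prod.smul_fst, Prod.snd_add, Prod.smul_snd,
      smul_eq_mul] at hc
    have hw : (1 - t) • x + t • y = x + t • (y - x) := by module
    rw [hw] at hc
    have h := (hmin (x + t • (y - x))).trans (add_le_add_left hc _)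
    rw [← ex] at h
    norm_cast at h
    have hn : ‖x + t • (y - x) - u‖ ^ 2 =
        ‖x - u‖ ^ 2 + 2 * (t * inner ℝ (x - u) (y - x)) + t ^ 2 * ‖y - x‖ ^ 2 := by
      rw [show x + t • (y - x) - u = (x - u) + t • (y - x) by abel, norm_add_sq_real,
        inner_smul_right, norm_smul, mul_pow, Real.norm_eq_abs, sq_abs]
    rw [hn] at h
    have hi : inner ℝ (γ⁻¹ • (u - x)) (y - x) = -(γ⁻¹ * inner ℝ (x - u) (y - x)) := by
      rw [real_inner_smul_left, ← neg_sub x u, inner_neg_left]; ring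
    rw [hi]
    have h2 : 1 / (2 * γ) = γ⁻¹ / 2 := by field_simp
    rw [h2] at h ⊢
    refine le_of_mul_le_mul_left ?_ ht.1
    nlinarith
  have hlim : a + inner ℝ (γ⁻¹ • (u - x)) (y - x) ≤ b := by
    have ht : Tendsto (fun t : ℝ => b + t * (1 / (2 * γ) * ‖y - x‖ ^ 2)) (𝓝[>] 0) (𝓝 b) := by
      have : Continuous (fun t : ℝ => b + t * (1 / (2 * γ) * ‖y - x‖ ^ 2)) := by fun_prop
      simpa using (this.tendsto 0).mono_left nhdsWithin_le_nhds
    exact ge_of_tendsto ht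
      (eventually_of_mem (Ioo_mem_nhdsGT one_pos) key)
  rw [← ex, ← ey]
  exact_mod_cast hlim

/-- The proximity operator is nonexpansive. -/
lemma IsProperConvexLSC.norm_sub_le_of_mem_proxArgmin (hg : IsProperConvexLSC g) {γ : ℝ}
    (hγ : 0 < γ) {u u' x x' : Euc n} (hx : x ∈ proxArgmin γ g u)
    (hx' : x' ∈ proxArgmin γ g u') : ‖x - x'‖ ≤ ‖u - u'‖ := by
  have h := hg.inner_sub_nonneg (hg.mem_subdiff_of_mem_proxArgmin hγ hx)
    (hg.mem_subdiff_of_mem_proxArgmin hγ hx')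
  rw [← smul_sub, real_inner_smul_left] at h
  have h1 : 0 ≤ inner ℝ (u - x - (u' - x')) (x - x') :=
    nonneg_of_mul_nonneg_right h (inv_pos.2 hγ)
  rw [show u - x - (u' - x') = (u - u') - (x - x') by abel, inner_sub_left,
    real_inner_self_eq_norm_sq] at h1
  have h2 := real_inner_le_norm (u - u') (x - x')
  by_contra! hlt
  nlinarith [norm_nonneg (u - u'), norm_nonneg (x - x')]

/-- The proximal problem has a solution as soon as `g` has a subgradient somewhere. -/
lemma IsProperConvexLSC.proxArgmin_nonempty (hg : IsProperConvexLSC g) {γ : ℝ}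
    (hγ : 0 < γ) {x v : Euc n} (hv : v ∈ subdiff g x) (u : Euc n) :
    (proxArgmin γ g u).Nonempty := by
  set f : Euc n → EReal := fun w => g w + ((1 / (2 * γ) * ‖w - u‖ ^ 2 : ℝ) : EReal)
  have hlsc : LowerSemicontinuous f := by
    refine hg.lowerSemicontinuous.add' (Continuous.lowerSemicontinuous ?_) fun w =>
      EReal.continuousAt_add (Or.inr (EReal.coe_ne_bot _)) (Or.inr (EReal.coe_ne_top _))
    exact continuous_coe_real_ereal.comp (by fun_prop)
  -- Beyond this radius `‖w - x‖ ^ 2` dominates the linear losses from the subgradient bound and the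
  -- cross term, so `f w ≥ f x`.
  set R := 2 * γ * ‖v‖ + 2 * ‖x - u‖
  have hR : 0 ≤ R := by positivity
  obtain ⟨z, hz, hzmin⟩ := LowerSemicontinuousOn.exists_isMinOn (f := f)
    ⟨x, Metric.mem_closedBall_self hR⟩ (isCompact_closedBall x R)
    (hlsc.lowerSemicontinuousOn _)
  refine ⟨z, fun w _ => ?_⟩
  by_cases hw : w ∈ Metric.closedBall x R
  · exact hzmin hw
  have hzx : f z ≤ f x := hzmin (Metric.mem_closedBall_self hR)
  refine hzx.trans ?_
  rw [Metric.mem_closedBall, dist_eq_norm, not_le] at hw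
  refine le_trans ?_ (add_le_add_left (hv w) _)
  change g x + ((1 / (2 * γ) * ‖x - u‖ ^ 2 : ℝ) : EReal) ≤ _
  rw [← EReal.coe_toReal (hg.ne_top_of_mem_subdiff hv) (hg.ne_bot x)]
  norm_cast
  have hn : ‖w - u‖ ^ 2 = ‖w - x‖ ^ 2 + 2 * inner ℝ (w - x) (x - u) + ‖x - u‖ ^ 2 := by
    rw [← norm_add_sq_real, sub_add_sub_cancel]
  have h1 := neg_le_of_abs_le (abs_real_inner_le_norm v (w - x))
  have h2 := neg_le_of_abs_le (abs_real_inner_le_norm (w - x) (x - u))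
  have h3 : 0 ≤ 2 * γ * inner ℝ v (w - x) + (‖w - u‖ ^ 2 - ‖x - u‖ ^ 2) := by
    have h4 : 2 * γ * -(‖v‖ * ‖w - x‖) ≤ 2 * γ * inner ℝ v (w - x) := by gcongr
    have h5 : R * ‖w - x‖ ≤ ‖w - x‖ * ‖w - x‖ := by gcongr
    rw [hn]
    simp only [R] at h5
    nlinarith
  have h6 : 0 ≤ 1 / (2 * γ) * (2 * γ * inner ℝ v (w - x) + (‖w - u‖ ^ 2 - ‖x - u‖ ^ 2)) := by
    positivity
  have h7 : 1 / (2 * γ) * (2 * γ * inner ℝ v (w - x)) = inner ℝ v (w - x) := by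
    field_simp
  rw [mul_add, h7] at h6
  linarith

/-- Uniqueness is nonexpansiveness applied to two minimizers for the same `u`. -/
lemma IsProperConvexLSC.exists_isProx (hg : IsProperConvexLSC g) {γ : ℝ}
    (hγ : 0 < γ) {x v : Euc n} (hv : v ∈ subdiff g x) (u : Euc n) : ∃ z, IsProx γ g u z := by
  obtain ⟨z, hz⟩ := hg.proxArgmin_nonempty hγ hv u
  refine ⟨z, eq_singleton_iff_unique_mem.2 ⟨hz, fun y hy => ?_⟩⟩
  have := hg.norm_sub_le_of_mem_proxArgmin hγ hy hz
  rwa [sub_self, norm_zero, norm_le_zero_iff, sub_eq_zero] at this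

end Subdifferential

/-- From a point of the relative interior one can move a little in every direction of the space
parallel to the affine hull. -/
lemma exists_pos_add_smul_mem_of_mem_intrinsicInterior {E : Type*} [NormedAddCommGroup E]
    [NormedSpace ℝ E] {s : Set E} {v d : E} (hv : v ∈ intrinsicInterior ℝ s)
    (hd : d ∈ vectorSpan ℝ s) : ∃ δ : ℝ, 0 < δ ∧ v + δ • d ∈ s := by
  obtain ⟨y, hy, rfl⟩ := mem_intrinsicInterior.1 hv
  rw [← direction_affineSpan] at hd
  let c : ℝ → affineSpan ℝ s := fun t =>
    ⟨(t • d) +ᵥ (y : E), AffineSubspace.vadd_mem_of_mem_direction (Submodule.smul_mem _ t hd) y.2⟩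
  have hc : Continuous c := by
    refine Continuous.subtype_mk ?_ _
    simp only [vadd_eq_add]
    fun_prop
  have hc0 : c 0 = y := Subtype.ext (by simp [c])
  have hev : ∀ᶠ t in 𝓝[>] (0 : ℝ), c t ∈ interior ((↑) ⁻¹' s : Set (affineSpan ℝ s)) :=
    ((hc.tendsto 0).mono_left nhdsWithin_le_nhds).eventually
      (isOpen_interior.mem_nhds (by rwa [hc0]))
  obtain ⟨δ, hδ, hδ0⟩ := (hev.and self_mem_nhdsWithin).exists
  refine ⟨δ, hδ0, ?_⟩
  have := interior_subset hδ
  simpa [c, add_comm] using this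

/-- Points near `x` have a nearest point on a compact piece of the manifold, the residual being
normal to the manifold there. -/
lemma IsLocalParam.exists_tendsto_normal {n p : ℕ} {k : WithTop ℕ∞} {M : Set (Euc n)} {x : Euc n}
    {φ : Euc p → Euc n} (h : IsLocalParam k M x φ) (hk : 1 ≤ k) {X : ℕ → Euc n}
    (hX : Tendsto X atTop (𝓝 x)) :
    ∃ t : ℕ → Euc p, Tendsto t atTop (𝓝 0) ∧ Tendsto (fun i => φ (t i)) atTop (𝓝[M] x) ∧
      (∀ i, φ (t i) ∈ M) ∧
      ∀ᶠ i in atTop, ∀ w, inner ℝ (X i - φ (t i)) (fderiv ℝ φ (t i) w) = 0 := by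
  obtain ⟨h0, -, U, hUo, hU0, hφ, hemb, hUM, -⟩ := h
  obtain ⟨r, hr, hrU⟩ := Metric.nhds_basis_closedBall.mem_iff.1 (hUo.mem_nhds hU0)
  have hcont : ContinuousOn φ (Metric.closedBall 0 r) := hφ.continuousOn.mono hrU
  have hex : ∀ i, ∃ t ∈ Metric.closedBall (0 : Euc p) r,
      IsMinOn (fun t => ‖X i - φ t‖) (Metric.closedBall 0 r) t := fun i =>
    (isCompact_closedBall _ _).exists_isMinOn ⟨0, Metric.mem_closedBall_self hr.le⟩
      (continuousOn_const.sub hcont).norm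
  choose t htr htmin using hex
  have hφt : Tendsto (fun i => φ (t i)) atTop (𝓝 x) := by
    have hX0 : Tendsto (fun i => ‖X i - x‖) atTop (𝓝 0) :=
      tendsto_iff_norm_sub_tendsto_zero.1 hX
    rw [tendsto_iff_norm_sub_tendsto_zero]
    refine squeeze_zero (fun _ => norm_nonneg _) (fun i => ?_)
      (by simpa using hX0.const_mul 2)
    -- The parameter `0` is a competitor, with value `φ 0 = x`.
    have h1 : ‖X i - φ (t i)‖ ≤ ‖X i - x‖ := by
      simpa [h0] using htmin i (Metric.mem_closedBall_self hr.le)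
    have h2 := norm_sub_le (X i - x) (X i - φ (t i))
    rw [sub_sub_sub_cancel_left] at h2
    linarith
  have ht0 : Tendsto t atTop (𝓝 0) := by
    have hs : Tendsto (fun i => (⟨t i, hrU (htr i)⟩ : U)) atTop (𝓝 ⟨0, hU0⟩) := by
      rw [hemb.tendsto_nhds_iff]
      simpa [Function.comp_def, h0] using hφt
    exact (continuous_subtype_val.tendsto _).comp hs
  have hM : ∀ i, φ (t i) ∈ M := fun i => hUM (mem_image_of_mem _ (hrU (htr i)))
  refine ⟨t, ht0, tendsto_nhdsWithin_iff.2 ⟨hφt, Eventually.of_forall hM⟩, hM, ?_⟩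
  -- Once `t i` lies in the open ball, the constrained minimum is a local one and the derivative
  -- vanishes.
  filter_upwards [ht0.eventually (Metric.ball_mem_nhds 0 hr)] with i hi w
  have hd : HasFDerivAt φ (fderiv ℝ φ (t i)) (t i) :=
    ((hφ.contDiffAt (hUo.mem_nhds (hrU (htr i)))).differentiableAt
      (by rintro rfl; simp at hk)).hasFDerivAt
  have hloc : IsLocalMin (fun s => ‖X i - φ s‖ ^ 2) (t i) := by
    filter_upwards [Metric.isOpen_ball.mem_nhds hi] with s hs
    have : ‖X i - φ (t i)‖ ≤ ‖X i - φ s‖ := htmin i (Metric.ball_subset_closedBall hs)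
    gcongr
  have hz := hloc.hasFDerivAt_eq_zero (hd.const_sub (X i)).norm_sq
  have hzw := congrArg (fun L => L w) hz
  rw [inner_sub_left]
  have hzw' : inner ℝ (φ (t i)) ((fderiv ℝ φ (t i)) w) -
      inner ℝ (X i) ((fderiv ℝ φ (t i)) w) = 0 := by simpa using hzw
  linarith

/-- Identification: a sequence converging to `x`, with subgradients converging to a point of the
relative interior of the subdifferential at `x`, meets the manifold. -/
lemma IsPartlySmoothAt.exists_mem {n : ℕ} {g : Euc n → EReal} {M : Set (Euc n)} {x v : Euc n}
    (hps : IsPartlySmoothAt g M x) (hri : v ∈ intrinsicInterior ℝ (subdiff g x))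
    {X V : ℕ → Euc n} (hX : Tendsto X atTop (𝓝 x)) (hV : Tendsto V atTop (𝓝 v))
    (hVX : ∀ i, V i ∈ subdiff g (X i)) : ∃ i, X i ∈ M := by
  by_contra! hXM
  obtain ⟨p, φ, hφ, hT⟩ := hps.sharp
  obtain ⟨t, ht0, hφt, htM, hnormal⟩ := hφ.exists_tendsto_normal one_le_two hX
  have hpos : ∀ i, 0 < ‖X i - φ (t i)‖ := fun i =>
    norm_pos_iff.2 (sub_ne_zero.2 fun h => hXM i (h ▸ htM i))
  set e : ℕ → Euc n := fun i => ‖X i - φ (t i)‖⁻¹ • (X i - φ (t i)) with he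
  have he1 : ∀ i, ‖e i‖ = 1 := fun i => by
    rw [he, norm_smul, norm_inv, norm_norm, inv_mul_cancel₀ (hpos i).ne']
  obtain ⟨d, hd, σ, hσ, hed⟩ := (isCompact_sphere (0 : Euc n) 1).tendsto_subseq
    (x := e) fun i => by simp [he1]
  have hd1 : ‖d‖ = 1 := by simpa using hd
  have hσ' := hσ.tendsto_atTop
  have hD : ContinuousAt (fderiv ℝ φ) 0 := by
    obtain ⟨-, -, U, hUo, hU0, hφU, -⟩ := hφ
    exact (hφU.contDiffAt (hUo.mem_nhds hU0)).continuousAt_fderiv two_ne_zero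
  have hdT : d ∈ vectorSpan ℝ (subdiff g x) := by
    rw [← Submodule.orthogonal_orthogonal (vectorSpan ℝ (subdiff g x)), ← hT,
      Submodule.mem_orthogonal']
    rintro _ ⟨w, rfl⟩
    have hlim : Tendsto (fun i => inner ℝ (e (σ i)) (fderiv ℝ φ (t (σ i)) w)) atTop
        (𝓝 (inner ℝ d (fderiv ℝ φ 0 w))) :=
      hed.inner ((((ContinuousLinearMap.apply ℝ (Euc n) w).continuous.tendsto _).comp
        (hD.tendsto.comp (ht0.comp hσ'))))
    refine tendsto_nhds_unique hlim (tendsto_const_nhds.congr' ?_)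
    filter_upwards [hσ'.eventually hnormal] with i hi
    rw [he, real_inner_smul_left, hi w, mul_zero]
  obtain ⟨δ, hδ, hmem⟩ := exists_pos_add_smul_mem_of_mem_intrinsicInterior hri hdT
  -- Two errors of at most `δ / 4` leave `δ / 2`, short of the `δ` reached by `δ * inner ℝ d (e (σ
  -- i))` in the limit.
  have hw := (hφt.comp hσ').eventually
    (hps.continuous.2 _ hmem _ (Metric.ball_mem_nhds _ (by positivity : 0 < δ / 4)))
  have hv := (hV.comp hσ').eventually (Metric.ball_mem_nhds v (by positivity : 0 < δ / 4))
  have hle : ∀ᶠ i in atTop, δ * inner ℝ d (e (σ i)) ≤ δ / 2 := by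
    filter_upwards [hw, hv] with i ⟨w, hwS, hwB⟩ hvB
    have hm := hps.properConvexLSC.inner_sub_nonneg (hVX (σ i)) hwS
    have hme : 0 ≤ inner ℝ (V (σ i) - w) (e (σ i)) := by
      rw [he, real_inner_smul_right]
      exact mul_nonneg (inv_nonneg.2 (norm_nonneg _)) hm
    have h1 := real_inner_le_norm (V (σ i) - v) (e (σ i))
    have h2 := real_inner_le_norm (v + δ • d - w) (e (σ i))
    rw [he1, mul_one] at h1 h2
    have h3 : ‖V (σ i) - v‖ < δ / 4 := by simpa [dist_eq_norm] using hvB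
    have h4 : ‖v + δ • d - w‖ < δ / 4 := by
      rw [norm_sub_rev]; simpa [dist_eq_norm] using hwB
    rw [show V (σ i) - w = (V (σ i) - v) + (v + δ • d - w) - δ • d by abel, inner_sub_left,
      inner_add_left, real_inner_smul_left] at hme
    linarith
  have hlim : Tendsto (fun i => δ * inner ℝ d (e (σ i))) atTop (𝓝 (δ * inner ℝ d d)) :=
    (tendsto_const_nhds.inner hed).const_mul δ
  have := le_of_tendsto hlim hle
  rw [real_inner_self_eq_norm_sq, hd1] at this
  linarith

theorem lemma4 {n : ℕ} (γ : ℝ) (hγ : 0 < γ) (g : Euc n → EReal) (M : Set (Euc n))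
    (ustar xstar : Euc n) (hprox : IsProx γ g ustar xstar) (hxM : xstar ∈ M)
    (hps : IsPartlySmoothAt g M xstar)
    (hri : γ⁻¹ • (ustar - xstar) ∈ intrinsicInterior ℝ (subdiff g xstar)) :
    QualifyingCondition γ g M ustar := by
  have hg := hps.properConvexLSC
  have hmem : ∀ {u x}, IsProx γ g u x → x ∈ proxArgmin γ g u := fun {u x} h =>
    (h : proxArgmin γ g u = {x}) ▸ mem_singleton x
  choose P hP using hg.exists_isProx hγ (intrinsicInterior_subset hri)
  by_contra hcon
  unfold QualifyingCondition at hcon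
  push Not at hcon
  choose u hu huM using fun i : ℕ => hcon (1 / (i + 1)) Nat.one_div_pos_of_nat
  have hu0 : Tendsto (fun i => ‖u i - ustar‖) atTop (𝓝 0) :=
    squeeze_zero (fun _ => norm_nonneg _)
      (fun i => by rw [← dist_eq_norm]; exact (Metric.mem_ball.1 (hu i)).le) tendsto_one_div_add_atTop_nhds_zero_nat
  have hut : Tendsto u atTop (𝓝 ustar) := tendsto_iff_norm_sub_tendsto_zero.2 hu0
  have hX : Tendsto (fun i => P (u i)) atTop (𝓝 xstar) :=
    tendsto_iff_norm_sub_tendsto_zero.2 <| squeeze_zero (fun _ => norm_nonneg _)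
      (fun i => hg.norm_sub_le_of_mem_proxArgmin hγ (hmem (hP (u i))) (hmem hprox)) hu0
  obtain ⟨i, hi⟩ := hps.exists_mem hri hX ((hut.sub hX).const_smul γ⁻¹)
    fun i => hg.mem_subdiff_of_mem_proxArgmin hγ (hmem (hP (u i)))
  exact huM i _ (hP (u i)) hi
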